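/- A graph here is finite and may have loops, but no multiple edges. The family of quasi-loop-threshold graphs is the smallest family of graphs, closed under isomorphism, that contains the one-vertex graph $K_1$ without a loop and the one-vertex graph $K_1^{\rm loop}$ with a loop, and is closed under taking disjoint unions and under adding looped dominating vertices (a new vertex that is looped and adjacent to all other vertices). For $n \ge 1$ let ${\rm qlt}_n$ be the number of labelled quasi-loop-threshold graphs on $n$ vertices, that is, of quasi-loop-threshold graphs with vertex set $[n]=\{1,\dots,n\}$, and let $S(m,k)$ denote the Stirling number of the second kind, the number of partitions of an $m$-element set into $k$ non-empty blocks. Then, for every $n \ge 1$, $$ {\rm qlt}_n=\sum_{k=1}^{n+1} S(n+1,k)\,k^{k-2}. $$ Moreover, there is a bijection between the labelled quasi-loop-threshold graphs on $[n]$ and the (unrooted) trees whose vertex set is the set of blocks of a partition of $[n+1]$ into non-empty blocks. -/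

import Mathlib

/-- A graph on the vertex set `V` that may have loops (`Adj v v` says that `v` is looped), but has
no multiple edges. -/
@[ext]
structure LoopGraph (V : Type) where
  Adj : V → V → Prop
  symm : ∀ u v, Adj u v → Adj v u

namespace LoopGraph

instance {V : Type} [Finite V] : Finite (LoopGraph V) :=
  Finite.of_injective LoopGraph.Adj fun _ _ h => LoopGraph.ext h

/-- The graph with a single vertex and no loop. -/
def K1 : LoopGraph Unit where
  Adj _ _ := False
  symm _ _ h := h

/-- The graph with a single vertex, which is looped. -/
def K1Loop : LoopGraph Unit where
  Adj _ _ := True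
  symm _ _ h := h

/-- The disjoint union of two graphs. -/
def disjointUnion {V W : Type} (G : LoopGraph V) (H : LoopGraph W) : LoopGraph (V ⊕ W) where
  Adj
    | .inl u, .inl v => G.Adj u v
    | .inr u, .inr v => H.Adj u v
    | .inl _, .inr _ => False
    | .inr _, .inl _ => False
  symm := by
    rintro (u | u) (v | v) h
    · exact G.symm u v h
    · exact h
    · exact h
    · exact H.symm u v h

/-- The graph obtained from `G` by adding a new vertex `none` that is looped and adjacent to every
vertex of `G`. -/
def addLoopedDominating {V : Type} (G : LoopGraph V) : LoopGraph (Option V) where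
  Adj
    | some u, some v => G.Adj u v
    | none, _ => True
    | some _, none => True
  symm := by
    rintro (_ | u) (_ | v) h
    · exact trivial
    · exact trivial
    · exact trivial
    · exact G.symm u v h

/-- The smallest isomorphism-closed family of graphs with possible loops that contains `K1` and
`K1Loop` and is closed under taking disjoint unions and adding looped dominating vertices. -/
inductive IsQuasiLoopThreshold : {V : Type} → LoopGraph V → Prop
  | k1 : IsQuasiLoopThreshold K1
  | k1Loop : IsQuasiLoopThreshold K1Loop
  | disjointUnion {V W : Type} {G : LoopGraph V} {H : LoopGraph W} :
      IsQuasiLoopThreshold G → IsQuasiLoopThreshold H →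
        IsQuasiLoopThreshold (G.disjointUnion H)
  | addLoopedDominating {V : Type} {G : LoopGraph V} :
      IsQuasiLoopThreshold G → IsQuasiLoopThreshold G.addLoopedDominating
  | iso {V W : Type} {G : LoopGraph V} {H : LoopGraph W} (e : V ≃ W)
      (he : ∀ u v, H.Adj (e u) (e v) ↔ G.Adj u v) :
      IsQuasiLoopThreshold G → IsQuasiLoopThreshold H

end LoopGraph

/-- The labelled quasi-loop-threshold graphs on an `n`-element label set. -/
abbrev QLTGraph (n : ℕ) : Type :=
  {G : LoopGraph (Fin n) // G.IsQuasiLoopThreshold}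

/-- The number of labelled quasi-loop-threshold graphs on `n` vertices. -/
noncomputable def qlt (n : ℕ) : ℕ := Nat.card (QLTGraph n)

/-- The (unrooted) partition trees on an `m`-element set: trees whose vertices are the blocks of a
partition of the set into non-empty blocks. -/
abbrev PartitionTree (m : ℕ) : Type :=
  (P : Finpartition (Finset.univ : Finset (Fin m))) × {T : SimpleGraph P.parts // T.IsTree}

/-! Write N(v) for the set of neighbours of v. The quasi-loop-threshold graphs are exactly the
non-empty finite graphs in which adjacent vertices have comparable neighbourhoods
(`isQuasiLoopThreshold_iff_isNested`).

Add an isolated unlooped vertex o to such a graph. Its recursive construction is then encoded by a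
rooted tree whose nodes are classes of vertices. The isolated unlooped vertices form the root, and
each component with edges hangs above it, starting with the class of its looped dominating vertices.
Once these are removed, the remaining isolated unlooped vertices, if any, form the next node, and so
on. The tree is recorded as the preorder `treeLE`.

The loops need not be recorded: a node is unlooped exactly when it is the root or the only child of
a looped node (`IsLoopPredicate`). Hence the graphs on [n] correspond to tree preorders on n + 1
points with least element o (`bijective_treeLE`). Such a preorder is a partition into k blocks
together with a tree on the blocks, rooted at the block of o. As the root is prescribed, Cayley's
formula gives k^(k-2) trees, and S(n+1,k) counts the partitions. Partition trees are counted by the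
same sum.

Cayley's formula is derived from a count of rooted forests with given roots
(`RootedForest.card_mul`). -/

namespace LoopGraph

/-! ### Nestedness characterises quasi-loop-threshold graphs. -/

/-- The neighbourhoods of any two adjacent vertices are comparable by inclusion. -/
def IsNested {V : Type} (G : LoopGraph V) : Prop :=
  ∀ u v, G.Adj u v → (∀ w, G.Adj u w → G.Adj v w) ∨ (∀ w, G.Adj v w → G.Adj u w)

/-- The graph induced along a map. -/
def comap {V W : Type} (f : V → W) (G : LoopGraph W) : LoopGraph V where
  Adj u v := G.Adj (f u) (f v)
  symm _ _ h := G.symm _ _ h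

theorem IsNested.comap {V W : Type} (f : V → W) {G : LoopGraph W} (h : G.IsNested) :
    (G.comap f).IsNested := by
  intro u v huv
  rcases h _ _ huv with h | h
  · exact Or.inl fun w => h (f w)
  · exact Or.inr fun w => h (f w)

theorem IsQuasiLoopThreshold.isNested {V : Type} {G : LoopGraph V}
    (h : G.IsQuasiLoopThreshold) : G.IsNested := by
  induction h with
  | k1 => intro _ _ h; exact h.elim
  | k1Loop => intro _ _ _; exact Or.inl fun _ h => h
  | disjointUnion _ _ ih₁ ih₂ =>
    rintro (u | u) (v | v) huv
    · refine (ih₁ u v huv).imp ?_ ?_ <;>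
      · rintro h (w | w) hw
        exacts [h w hw, hw]
    · exact huv.elim
    · exact huv.elim
    · refine (ih₂ u v huv).imp ?_ ?_ <;>
      · rintro h (w | w) hw
        exacts [hw, h w hw]
  | addLoopedDominating _ ih =>
    rintro (_ | u) (_ | v) huv
    · exact Or.inl fun _ h => h
    · exact Or.inr fun _ _ => trivial
    · exact Or.inl fun _ _ => trivial
    · refine (ih u v huv).imp ?_ ?_ <;>
      · rintro h (_ | w) hw
        exacts [trivial, h w hw]
  | iso e he _ ih =>
    intro u v huv
    obtain ⟨u, rfl⟩ := e.surjective u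
    obtain ⟨v, rfl⟩ := e.surjective v
    refine (ih u v ((he u v).1 huv)).imp ?_ ?_ <;>
    · intro h w hw
      obtain ⟨w, rfl⟩ := e.surjective w
      exact (he _ _).2 (h w ((he _ _).1 hw))

/-- In a nested graph, a vertex with the most neighbours is adjacent to all neighbours of its
neighbours. -/
theorem IsNested.exists_closed_neighbors {V : Type} [Finite V] [Nonempty V] {G : LoopGraph V}
    (h : G.IsNested) : ∃ v, ∀ u w, G.Adj v u → G.Adj u w → G.Adj v w := by
  obtain ⟨v, hv⟩ := Finite.exists_max fun v => {w | G.Adj v w}.ncard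
  refine ⟨v, fun u w hvu huw => ?_⟩
  -- If N(v) ⊆ N(u), maximality of |N(v)| forces equality.
  rcases h v u hvu with h' | h'
  · have : {w | G.Adj v w} = {w | G.Adj u w} :=
      Set.eq_of_subset_of_ncard_le (fun w hw => h' w hw) (hv u) (Set.toFinite _)
    exact (Set.ext_iff.1 this w).2 huw
  · exact h' w huw

theorem IsQuasiLoopThreshold.of_induced_split {V : Type} {G : LoopGraph V} (p : V → Prop)
    (hp : ∀ u v, p u → ¬ p v → ¬ G.Adj u v)
    (h₁ : (G.comap (Subtype.val : {v // p v} → V)).IsQuasiLoopThreshold)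
    (h₂ : (G.comap (Subtype.val : {v // ¬ p v} → V)).IsQuasiLoopThreshold) :
    G.IsQuasiLoopThreshold := by
  classical
  refine .iso (Equiv.sumCompl p) ?_ (.disjointUnion h₁ h₂)
  rintro (u | u) (v | v)
  · rfl
  · exact ⟨hp u v u.2 v.2, False.elim⟩
  · exact ⟨fun h => hp v u v.2 u.2 (G.symm _ _ h), False.elim⟩
  · rfl

theorem IsQuasiLoopThreshold.of_dominating {V : Type} {G : LoopGraph V} (v : V)
    (hv : ∀ w, G.Adj v w)
    (h : (G.comap (Subtype.val : {w // w ≠ v} → V)).IsQuasiLoopThreshold) :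
    G.IsQuasiLoopThreshold := by
  classical
  refine .iso (Equiv.optionSubtypeNe v) ?_ (.addLoopedDominating h)
  rintro (_ | u) (_ | w)
  · exact ⟨fun _ => trivial, fun _ => hv v⟩
  · exact ⟨fun _ => trivial, fun _ => hv w⟩
  · exact ⟨fun _ => trivial, fun _ => G.symm _ _ (hv u)⟩
  · rfl

theorem IsQuasiLoopThreshold.of_unique {V : Type} [Unique V] (G : LoopGraph V) :
    G.IsQuasiLoopThreshold := by
  by_cases h : G.Adj default default
  · refine .iso (Equiv.ofUnique Unit V) (fun u v => ?_) .k1Loop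
    rw [Unique.eq_default (Equiv.ofUnique Unit V u)]
    exact ⟨fun _ => trivial, fun _ => h⟩
  · refine .iso (Equiv.ofUnique Unit V) (fun u v => ?_) .k1
    rw [Unique.eq_default (Equiv.ofUnique Unit V u)]
    exact ⟨fun h' => h h', False.elim⟩

theorem IsNested.isQuasiLoopThreshold {V : Type} [Finite V] [Nonempty V] {G : LoopGraph V}
    (hG : G.IsNested) : G.IsQuasiLoopThreshold := by
  induction hn : Nat.card V using Nat.strong_induction_on generalizing V with
  | _ n ih =>
    have sub (p : V → Prop) (x y : V) (hx : p x) (hy : ¬ p y) :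
        (G.comap (Subtype.val : {v // p v} → V)).IsQuasiLoopThreshold := by
      have : Nonempty {v // p v} := ⟨⟨x, hx⟩⟩
      refine ih _ ?_ (hG.comap _) rfl
      rw [← hn]
      exact Finite.card_subtype_lt hy
    -- No edge leaves N(v). If N(v) is everything, v is a looped dominating vertex; if it is proper
    -- and non-empty, it splits the graph; if it is empty, v itself splits off.
    obtain ⟨v, hv⟩ := hG.exists_closed_neighbors
    by_cases hdom : ∀ w, G.Adj v w
    · by_cases hw : ∃ w, w ≠ v
      · obtain ⟨w, hw⟩ := hw
        exact .of_dominating v hdom (sub (fun w => w ≠ v) w v hw (not_not.2 rfl))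
      · push Not at hw
        let _ : Unique V := ⟨⟨v⟩, hw⟩
        exact .of_unique G
    · by_cases hiso : ∃ u, G.Adj v u
      · obtain ⟨u, hu⟩ := hiso
        push Not at hdom
        obtain ⟨w, hw⟩ := hdom
        refine .of_induced_split (fun x => G.Adj v x)
          (fun a b ha hb hab => hb (hv a b ha hab)) (sub _ u w hu hw)
          (sub _ w u hw (not_not.2 hu))
      · push Not at hiso
        by_cases hw : ∃ w, w ≠ v
        · obtain ⟨w, hw⟩ := hw
          refine .of_induced_split (fun x => x = v) ?_ (sub _ v w rfl hw)
            (sub _ w v hw (not_not.2 rfl))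
          rintro a b rfl _
          exact hiso b
        · push Not at hw
          let _ : Unique V := ⟨⟨v⟩, hw⟩
          exact .of_unique G

theorem isQuasiLoopThreshold_iff_isNested {V : Type} [Finite V] [Nonempty V] {G : LoopGraph V} :
    G.IsQuasiLoopThreshold ↔ G.IsNested :=
  ⟨IsQuasiLoopThreshold.isNested, IsNested.isQuasiLoopThreshold⟩

end LoopGraph

/-! ### The tree preorder of a nested graph. -/

/-- A preorder with least element `o` in which the elements below any element form a chain. -/
structure IsTreePreorder {W : Type} (o : W) (le : W → W → Prop) : Prop where
  refl : ∀ u, le u u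
  trans : ∀ u v w, le u v → le v w → le u w
  chain : ∀ u v w, le u w → le v w → le u v ∨ le v u
  bot : ∀ u, le o u

namespace LoopGraph

/-- The preorder of a nested graph: the vertices of a component sit above its looped dominating
vertices, and vertices with the same neighbourhood above the unlooped vertices among them. -/
def treeLE {W : Type} (G : LoopGraph W) (u v : W) : Prop :=
  (G.Adj u u ∧ G.Adj u v ∧ ∀ w, G.Adj v w → G.Adj u w) ∨
    (¬ G.Adj u u ∧ ¬ G.Adj u v ∧ ∀ w, G.Adj u w → G.Adj v w)

section

variable {W : Type} {G : LoopGraph W} {o : W}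

theorem treeLE_of_loop {u v : W} (hu : G.Adj u u) :
    G.treeLE u v ↔ G.Adj u v ∧ ∀ w, G.Adj v w → G.Adj u w := by
  simp [treeLE, hu]

theorem treeLE_of_not_loop {u v : W} (hu : ¬ G.Adj u u) :
    G.treeLE u v ↔ ¬ G.Adj u v ∧ ∀ w, G.Adj u w → G.Adj v w := by
  simp [treeLE, hu]

/-- The other inclusion, N(v) ⊆ N(u), would put u in its own neighbourhood. -/
theorem IsNested.subset_of_not_loop (h : G.IsNested) {u v : W} (hu : ¬ G.Adj u u)
    (huv : G.Adj u v) : ∀ w, G.Adj u w → G.Adj v w := by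
  rcases h u v huv with h | h
  · exact h
  · exact (hu (h u (G.symm _ _ huv))).elim

theorem IsNested.isTreePreorder (h : G.IsNested) (ho : ∀ v, ¬ G.Adj o v) :
    IsTreePreorder o G.treeLE where
  refl u := by
    by_cases hu : G.Adj u u
    · exact (treeLE_of_loop hu).2 ⟨hu, fun _ h => h⟩
    · exact (treeLE_of_not_loop hu).2 ⟨hu, fun _ h => h⟩
  trans u v w huv hvw := by
    by_cases hu : G.Adj u u <;> by_cases hv : G.Adj v v
    · rw [treeLE_of_loop hu] at huv ⊢
      rw [treeLE_of_loop hv] at hvw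
      exact ⟨huv.2 _ hvw.1, fun x hx => huv.2 _ (hvw.2 _ hx)⟩
    · rw [treeLE_of_loop hu] at huv ⊢
      rw [treeLE_of_not_loop hv] at hvw
      have huw : G.Adj u w := G.symm _ _ (hvw.2 _ (G.symm _ _ huv.1))
      refine ⟨huw, (h u w huw).resolve_left fun h' => ?_⟩
      exact hvw.1 (G.symm _ _ (h' v huv.1))
    · rw [treeLE_of_not_loop hu] at huv ⊢
      rw [treeLE_of_loop hv] at hvw
      refine ⟨fun huw => huv.1 (G.symm _ _ (hvw.2 _ (G.symm _ _ huw))), fun x hx => ?_⟩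
      rcases h v x (huv.2 x hx) with h' | h'
      · exact G.symm _ _ (h' _ hvw.1)
      · exact (huv.1 (G.symm _ _ (h' _ (G.symm _ _ hx)))).elim
    · rw [treeLE_of_not_loop hu] at huv ⊢
      rw [treeLE_of_not_loop hv] at hvw
      exact ⟨fun huw => hvw.1 (huv.2 _ huw), fun x hx => hvw.2 _ (huv.2 _ hx)⟩
  chain := by
    have key : ∀ u v w, G.Adj u u → ¬ G.Adj v v → G.treeLE u w → G.treeLE v w →
        G.treeLE u v ∨ G.treeLE v u := by
      intro u v w hu hv huw hvw
      rw [treeLE_of_loop hu] at huw ⊢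
      rw [treeLE_of_not_loop hv] at hvw ⊢
      by_cases hvu : G.Adj v u
      · exact Or.inl ⟨G.symm _ _ hvu, h.subset_of_not_loop hv hvu⟩
      · exact Or.inr ⟨hvu, fun x hx => huw.2 _ (hvw.2 _ hx)⟩
    intro u v w huw hvw
    by_cases hu : G.Adj u u <;> by_cases hv : G.Adj v v
    · rw [treeLE_of_loop hu] at huw ⊢
      rw [treeLE_of_loop hv] at hvw ⊢
      have huv : G.Adj u v := G.symm _ _ (hvw.2 _ (G.symm _ _ huw.1))
      exact (h u v huv).symm.imp (fun h' => ⟨huv, h'⟩) (fun h' => ⟨G.symm _ _ huv, h'⟩)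
    · exact key u v w hu hv huw hvw
    · exact (key v u w hv hu hvw huw).symm
    · rw [treeLE_of_not_loop hu] at huw ⊢
      rw [treeLE_of_not_loop hv] at hvw ⊢
      have huv : ¬ G.Adj u v := fun huv => hv (h.subset_of_not_loop hu huv _ huv)
      by_contra hcon
      simp only [huv, mt (G.symm v u) huv, not_false_eq_true, true_and] at hcon
      push Not at hcon
      -- Both x and y are neighbours of w, and N(w) ⊆ N(x), so x and y are adjacent; but u lies only
      -- in N(x) and v only in N(y), against nestedness.
      obtain ⟨⟨x, hux, hvx⟩, y, hvy, huy⟩ := hcon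
      have hxw : ∀ z, G.Adj w z → G.Adj x z :=
        (h x w (G.symm _ _ (huw.2 _ hux))).resolve_left fun h' =>
          huw.1 (G.symm _ _ (h' u (G.symm _ _ hux)))
      rcases h x y (hxw _ (hvw.2 _ hvy)) with h' | h'
      · exact huy (G.symm _ _ (h' _ (G.symm _ _ hux)))
      · exact hvx (G.symm _ _ (h' _ (G.symm _ _ hvy)))
  bot u := (treeLE_of_not_loop (ho o)).2 ⟨ho u, fun w hw => (ho w hw).elim⟩

/-- This recovers the graph from its preorder and its loops. Of two adjacent vertices, the one with
the larger neighbourhood is looped and lies below the other. -/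
theorem IsNested.adj_iff (h : G.IsNested) {u v : W} :
    G.Adj u v ↔ (G.Adj u u ∧ G.treeLE u v) ∨ (G.Adj v v ∧ G.treeLE v u) := by
  constructor
  · intro huv
    rcases h u v huv with h' | h'
    · have hv := h' v huv
      exact Or.inr ⟨hv, (treeLE_of_loop hv).2 ⟨G.symm _ _ huv, h'⟩⟩
    · have hu := h' u (G.symm _ _ huv)
      exact Or.inl ⟨hu, (treeLE_of_loop hu).2 ⟨huv, h'⟩⟩
  · rintro (⟨hu, huv⟩ | ⟨hv, hvu⟩)
    · exact ((treeLE_of_loop hu).1 huv).1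
    · exact G.symm _ _ ((treeLE_of_loop hv).1 hvu).1

end

end LoopGraph

/-! ### The preorder determines the loops. -/

/-- The nodes of a tree preorder are split into looped and unlooped ones: a node is unlooped if it
is the root, or the only child of a looped node. -/
def IsLoopPredicate {W : Type} (o : W) (le : W → W → Prop) (D : W → Prop) : Prop :=
  ∀ x, D x ↔ ¬ le x o ∧ ¬ ∃ p, (le p x ∧ ¬ le x p) ∧ D p ∧ ∀ z, le p z → ¬ le z p → le x z

namespace IsTreePreorder

variable {W : Type} {o : W} {le : W → W → Prop}

theorem wellFounded_lt [Finite W] (h : IsTreePreorder o le) :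
    WellFounded fun u v => le u v ∧ ¬ le v u := by
  have : IsTrans W fun u v => le u v ∧ ¬ le v u :=
    ⟨fun a b c hab hbc => ⟨h.trans _ _ _ hab.1 hbc.1,
      fun hca => hab.2 (h.trans _ _ _ hbc.1 hca)⟩⟩
  have : Std.Irrefl fun u v => le u v ∧ ¬ le v u := ⟨fun a ha => ha.2 ha.1⟩
  exact Finite.wellFounded_of_trans_of_irrefl _

/-- The condition at x consults D only at points strictly below x, so it is a well-founded
recursion. -/
theorem loopPredicate_unique [Finite W] (h : IsTreePreorder o le) {D D' : W → Prop}
    (hD : IsLoopPredicate o le D) (hD' : IsLoopPredicate o le D') : D = D' := by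
  funext x
  induction x using h.wellFounded_lt.induction with
  | _ x ih =>
    rw [eq_iff_iff, hD x, hD' x]
    refine and_congr_right fun _ => not_congr (exists_congr fun p => and_congr_right fun hp => ?_)
    rw [ih p hp]

theorem exists_loopPredicate [Finite W] (h : IsTreePreorder o le) :
    ∃ D, IsLoopPredicate o le D := by
  refine ⟨h.wellFounded_lt.fix fun x ih => ¬ le x o ∧
    ¬ ∃ p, ∃ hp : le p x ∧ ¬ le x p, ih p hp ∧ ∀ z, le p z → ¬ le z p → le x z, fun x => ?_⟩
  rw [WellFounded.fix_eq]
  simp only [exists_prop]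

end IsTreePreorder

namespace LoopGraph

/-- If x and p are looped with p strictly below x, then p has a neighbour not adjacent to x, and
this lies strictly above p but not above x. Conversely, an unlooped x outside the root class is the
only child of a neighbour with fewest neighbours. -/
theorem IsNested.isLoopPredicate {W : Type} [Finite W] {G : LoopGraph W} {o : W}
    (h : G.IsNested) (ho : ∀ v, ¬ G.Adj o v) :
    IsLoopPredicate o G.treeLE fun x => G.Adj x x := by
  intro x
  constructor
  · intro hx
    refine ⟨fun hxo => ho x (G.symm _ _ ((treeLE_of_loop hx).1 hxo).1), ?_⟩
    rintro ⟨p, ⟨hpx, hxp⟩, hp, hz⟩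
    rw [treeLE_of_loop hp] at hpx
    rw [treeLE_of_loop hx] at hxp
    push Not at hxp
    obtain ⟨z, hpz, hxz⟩ := hxp (G.symm _ _ hpx.1)
    have hzp : ¬ ∀ w, G.Adj p w → G.Adj z w := fun h' => hxz (G.symm _ _ (h' x hpx.1))
    refine hxz ((treeLE_of_loop hx).1 (hz z ?_ ?_)).1
    · exact (treeLE_of_loop hp).2 ⟨hpz, (h p z hpz).resolve_left hzp⟩
    · rintro (⟨_, _, h'⟩ | ⟨_, h', _⟩)
      · exact hzp h'
      · exact h' (G.symm _ _ hpz)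
  · rintro ⟨hxo, hx⟩
    by_contra hxx
    have hne : {p | G.Adj x p}.Nonempty := by
      by_contra hemp
      refine hxo ((treeLE_of_not_loop hxx).2 ⟨fun hx => ho x (G.symm _ _ hx), fun w hw => ?_⟩)
      exact (hemp ⟨w, hw⟩).elim
    obtain ⟨p, hxp, hmin⟩ := Set.exists_min_image {p | G.Adj x p}
      (fun p => {w | G.Adj p w}.ncard) (Set.toFinite _) hne
    have hle : ∀ y, G.Adj x y → G.Adj y p → ∀ w, G.Adj p w → G.Adj y w := by
      intro y hy hyp
      rcases h y p hyp with h' | h'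
      · have : {w | G.Adj y w} = {w | G.Adj p w} :=
          Set.eq_of_subset_of_ncard_le (fun w hw => h' w hw) (hmin y hy) (Set.toFinite _)
        exact fun w hw => (Set.ext_iff.1 this w).2 hw
      · exact h'
    have hsub := h.subset_of_not_loop hxx hxp
    have hpp : G.Adj p p := hsub p hxp
    refine hx ⟨p, ⟨(treeLE_of_loop hpp).2 ⟨G.symm _ _ hxp, hsub⟩,
      fun h' => ((treeLE_of_not_loop hxx).1 h').1 hxp⟩, hpp, fun z hpz hzp => ?_⟩
    rw [treeLE_of_loop hpp] at hpz
    rw [treeLE_of_not_loop hxx]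
    refine ⟨fun hxz => hzp ?_, fun y hy => ?_⟩
    · exact (treeLE_of_loop (h.subset_of_not_loop hxx hxz z hxz)).2
        ⟨G.symm _ _ hpz.1, hle z hxz (G.symm _ _ hpz.1)⟩
    · exact G.symm _ _ (hle y hy (G.symm _ _ (hsub y hy)) z hpz.1)

/-- The graph of a tree preorder with a set of looped nodes. -/
def ofTreePreorder {W : Type} (le : W → W → Prop) (D : W → Prop) : LoopGraph W where
  Adj u v := (D u ∧ le u v) ∨ (D v ∧ le v u)
  symm _ _ h := h.symm

end LoopGraph

namespace IsTreePreorder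

open LoopGraph

variable {W : Type} {o : W} {le : W → W → Prop} {D : W → Prop}

theorem loopPredicate_congr (h : IsTreePreorder o le) (hD : IsLoopPredicate o le D) {u v : W}
    (huv : le u v) (hvu : le v u) (hu : D u) : D v := by
  rw [hD] at hu ⊢
  refine ⟨fun hv => hu.1 (h.trans _ _ _ huv hv), ?_⟩
  rintro ⟨p, ⟨h₁, h₂⟩, hp, hz⟩
  exact hu.2 ⟨p, ⟨h.trans _ _ _ h₁ hvu, fun h' => h₂ (h.trans _ _ _ hvu h')⟩, hp,
    fun z hz₁ hz₂ => h.trans _ _ _ huv (hz z hz₁ hz₂)⟩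

theorem adj_self_iff (h : IsTreePreorder o le) {u : W} : (ofTreePreorder le D).Adj u u ↔ D u :=
  ⟨fun h' => h'.elim And.left And.left, fun hu => Or.inl ⟨hu, h.refl u⟩⟩

theorem adj_of_adj_of_le (h : IsTreePreorder o le) {u v : W} (hu : D u) (huv : le u v) (x : W)
    (hx : (ofTreePreorder le D).Adj v x) : (ofTreePreorder le D).Adj u x := by
  rcases hx with ⟨_, hvx⟩ | ⟨hx, hxv⟩
  · exact Or.inl ⟨hu, h.trans _ _ _ huv hvx⟩
  · exact (h.chain u x v huv hxv).imp (fun h' => ⟨hu, h'⟩) (fun h' => ⟨hx, h'⟩)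

theorem isNested_ofTreePreorder (h : IsTreePreorder o le) : (ofTreePreorder le D).IsNested := by
  rintro u v (⟨hu, huv⟩ | ⟨hv, hvu⟩)
  · exact Or.inr (h.adj_of_adj_of_le hu huv)
  · exact Or.inl (h.adj_of_adj_of_le hv hvu)

theorem not_adj_bot (h : IsTreePreorder o le) (hD : IsLoopPredicate o le D) (v : W) :
    ¬ (ofTreePreorder le D).Adj o v := by
  rintro (⟨ho, _⟩ | ⟨hv, hvo⟩)
  · exact ((hD o).1 ho).1 (h.refl o)
  · exact ((hD v).1 hv).1 hvo

theorem treeLE_ofTreePreorder [Finite W] (h : IsTreePreorder o le)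
    (hD : IsLoopPredicate o le D) : (ofTreePreorder le D).treeLE = le := by
  funext u v
  rw [eq_iff_iff]
  by_cases hu : D u
  · rw [treeLE_of_loop (h.adj_self_iff.2 hu)]
    refine ⟨?_, fun huv => ⟨Or.inl ⟨hu, huv⟩, h.adj_of_adj_of_le hu huv⟩⟩
    rintro ⟨⟨_, huv⟩ | ⟨hv, hvu⟩, hsub⟩
    · exact huv
    by_contra huv
    -- Here z₀ is the child of v on the way to u. If it is looped, it is not an only child, and a
    -- point above another child is adjacent to v but not to u. If it is unlooped, z₀ itself is
    -- adjacent to v but not to u.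
    obtain ⟨z₀, ⟨⟨hvz, hzv⟩, hzu⟩, hmin⟩ := h.wellFounded_lt.has_min
      {z | (le v z ∧ ¬ le z v) ∧ le z u} ⟨u, ⟨hvu, huv⟩, h.refl u⟩
    by_cases hz : D z₀
    · have := ((hD z₀).1 hz).2
      push Not at this
      obtain ⟨z, hz₁, hz₂, hz₃⟩ := this v ⟨hvz, hzv⟩ hv
      rcases hsub z (Or.inl ⟨hv, hz₁⟩) with ⟨_, huz⟩ | ⟨_, hzu'⟩
      · exact hz₃ (h.trans _ _ _ hzu huz)
      · exact hmin z ⟨⟨hz₁, hz₂⟩, hzu'⟩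
          ⟨(h.chain _ _ _ hzu hzu').resolve_left hz₃, hz₃⟩
    · rcases hsub z₀ (Or.inl ⟨hv, hvz⟩) with ⟨_, huz⟩ | ⟨hz', _⟩
      · exact hz (h.loopPredicate_congr hD huz hzu hu)
      · exact hz hz'
  · rw [treeLE_of_not_loop (mt h.adj_self_iff.1 hu)]
    constructor
    · rintro ⟨huv, hsub⟩
      have hu' := hu
      rw [hD, not_and_or, not_not, not_not] at hu'
      rcases hu' with huo | ⟨p, ⟨hpu, hup⟩, hp, hz⟩
      · exact h.trans _ _ _ huo (h.bot v)
      rcases hsub p (Or.inr ⟨hp, hpu⟩) with ⟨hv, hvp⟩ | ⟨_, hpv⟩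
      · exact (huv (Or.inr ⟨hv, h.trans _ _ _ hvp hpu⟩)).elim
      · refine hz v hpv fun hvp => huv (Or.inr ⟨?_, h.trans _ _ _ hvp hpu⟩)
        exact h.loopPredicate_congr hD hpv hvp hp
    · intro huv
      refine ⟨?_, ?_⟩
      · rintro (⟨hu', _⟩ | ⟨hv, hvu⟩)
        · exact hu hu'
        · exact hu (h.loopPredicate_congr hD hvu huv hv)
      · rintro x (⟨hu', _⟩ | ⟨hx, hxu⟩)
        · exact (hu hu').elim
        · exact Or.inr ⟨hx, h.trans _ _ _ hxu huv⟩

end IsTreePreorder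

/-! ### Quasi-loop-threshold graphs correspond to tree preorders. -/

namespace LoopGraph

/-- Nested graphs in which `o` is an isolated unlooped vertex correspond to tree preorders with
least element `o`. -/
theorem bijective_treeLE {W : Type} [Finite W] (o : W) :
    Function.Bijective (fun G : {G : LoopGraph W // G.IsNested ∧ ∀ v, ¬ G.Adj o v} =>
      (⟨G.1.treeLE, G.2.1.isTreePreorder G.2.2⟩ : {le // IsTreePreorder o le})) := by
  constructor
  · rintro ⟨G, hG, hGo⟩ ⟨H, hH, hHo⟩ hGH
    have hle : G.treeLE = H.treeLE := congrArg Subtype.val hGH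
    have hloop : (fun x => G.Adj x x) = fun x => H.Adj x x :=
      (hG.isTreePreorder hGo).loopPredicate_unique (hG.isLoopPredicate hGo)
        (hle ▸ hH.isLoopPredicate hHo)
    have hloop' : ∀ x, G.Adj x x ↔ H.Adj x x := fun x => iff_of_eq (congrFun hloop x)
    ext u v
    rw [hG.adj_iff, hH.adj_iff, hle, hloop' u, hloop' v]
  · rintro ⟨le, h⟩
    obtain ⟨D, hD⟩ := h.exists_loopPredicate
    exact ⟨⟨ofTreePreorder le D, h.isNested_ofTreePreorder, h.not_adj_bot hD⟩,
      Subtype.ext (h.treeLE_ofTreePreorder hD)⟩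

/-- Add an isolated unlooped vertex. -/
def addIsolated {V : Type} (G : LoopGraph V) : LoopGraph (Option V) where
  Adj
    | some u, some v => G.Adj u v
    | _, _ => False
  symm := by
    rintro (_ | u) (_ | v) h
    exacts [h, h, h, G.symm u v h]

theorem IsNested.addIsolated {V : Type} {G : LoopGraph V} (h : G.IsNested) :
    G.addIsolated.IsNested := by
  rintro (_ | u) (_ | v) huv
  · exact huv.elim
  · exact huv.elim
  · exact huv.elim
  · refine (h u v huv).imp ?_ ?_ <;>
    · rintro h' (_ | w) hw
      exacts [hw, h' w hw]

theorem not_adj_addIsolated {V : Type} {G : LoopGraph V} (v : Option V) :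
    ¬ G.addIsolated.Adj none v := by
  cases v <;> exact id

/-- The extra vertex accounts for n + 1 in place of n: it keeps the root class non-empty even if no
vertex of the graph is isolated and unlooped. -/
theorem bijective_addIsolated (V : Type) :
    Function.Bijective (fun G : {G : LoopGraph V // G.IsNested} =>
      (⟨G.1.addIsolated, G.2.addIsolated, not_adj_addIsolated⟩ :
        {G : LoopGraph (Option V) // G.IsNested ∧ ∀ v, ¬ G.Adj none v})) := by
  constructor
  · rintro ⟨G, hG⟩ ⟨H, hH⟩ hGH
    ext u v
    exact iff_of_eq (congrArg (fun K => K.1.Adj (some u) (some v)) hGH)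
  · rintro ⟨G, hG, hGo⟩
    refine ⟨⟨G.comap some, hG.comap some⟩, Subtype.ext ?_⟩
    ext (_ | u) (_ | v)
    · exact ⟨False.elim, hGo _⟩
    · exact ⟨False.elim, hGo _⟩
    · exact ⟨False.elim, fun h => hGo _ (G.symm _ _ h)⟩
    · rfl

end LoopGraph

theorem qlt_eq_card_isTreePreorder {n : ℕ} (hn : 1 ≤ n) :
    qlt n = Nat.card {le : Option (Fin n) → Option (Fin n) → Prop // IsTreePreorder none le} := by
  have : Nonempty (Fin n) := ⟨⟨0, hn⟩⟩
  rw [← Nat.card_congr (Equiv.ofBijective _ (LoopGraph.bijective_treeLE none)),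
    ← Nat.card_congr (Equiv.ofBijective _ (LoopGraph.bijective_addIsolated (Fin n)))]
  exact Nat.card_congr (Equiv.subtypeEquivRight fun _ =>
    LoopGraph.isQuasiLoopThreshold_iff_isNested)

/-! ### Counting rooted forests. -/

/-- The functions `N → N ⊕ Y` without cycles: the rooted forests with set of roots `Y` and set of
other vertices `N`. -/
abbrev RootedForest (N Y : Type) : Type :=
  {f : N → N ⊕ Y // ∃ h : N → ℕ, ∀ v w, f v = Sum.inl w → h w < h v}

namespace RootedForest

open Classical in
/-- The vertices whose parent is a root. -/
noncomputable def children {N Y : Type} [Fintype N] (f : RootedForest N Y) : Finset N :=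
  {v | ∃ y, f.1 v = Sum.inr y}

theorem mem_children {N Y : Type} [Fintype N] {f : RootedForest N Y} {v : N} :
    v ∈ f.children ↔ ∃ y, f.1 v = Sum.inr y := by
  simp [children]

open Classical in
/-- Put new roots below the roots of a forest. -/
noncomputable def glue {N Y : Type} (S : Finset N) (g : {v // v ∈ S} → Y)
    (f : RootedForest {v // v ∉ S} {v // v ∈ S}) : RootedForest N Y := by
  refine ⟨fun v => if hv : v ∈ S then .inr (g ⟨v, hv⟩) else
    .inl ((f.1 ⟨v, hv⟩).elim Subtype.val Subtype.val), ?_⟩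
  obtain ⟨h, hh⟩ := f.2
  refine ⟨fun v => if hv : v ∈ S then 0 else h ⟨v, hv⟩ + 1, fun v w hvw => ?_⟩
  by_cases hv : v ∈ S
  · simp [hv] at hvw
  · simp only [hv, dite_false, Sum.inl.injEq] at hvw ⊢
    cases hf : f.1 ⟨v, hv⟩ with
    | inl x =>
      rw [hf] at hvw
      subst hvw
      simpa [x.2] using hh _ _ hf
    | inr x =>
      rw [hf] at hvw
      subst hvw
      simp [x.2]

theorem glue_of_mem {N Y : Type} {S : Finset N} {g : {v // v ∈ S} → Y}
    {f : RootedForest {v // v ∉ S} {v // v ∈ S}} {v : N} (hv : v ∈ S) :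
    (glue S g f).1 v = .inr (g ⟨v, hv⟩) := by
  simp [glue, hv]

theorem glue_of_not_mem {N Y : Type} {S : Finset N} {g : {v // v ∈ S} → Y}
    {f : RootedForest {v // v ∉ S} {v // v ∈ S}} {v : N} (hv : v ∉ S) :
    (glue S g f).1 v = .inl ((f.1 ⟨v, hv⟩).elim Subtype.val Subtype.val) := by
  simp [glue, hv]

theorem children_glue {N Y : Type} [Fintype N] (S : Finset N) (g : {v // v ∈ S} → Y)
    (f : RootedForest {v // v ∉ S} {v // v ∈ S}) : (glue S g f).children = S := by
  ext v
  rw [mem_children]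
  by_cases hv : v ∈ S
  · simp [glue_of_mem hv, hv]
  · simp [glue_of_not_mem hv, hv]

/-- Deleting the roots leaves a forest whose roots are the set S of their children; only the map
from S to the old roots is lost. -/
theorem bijective_glue {N Y : Type} [Fintype N] (S : Finset N) :
    Function.Bijective (fun p : ({v // v ∈ S} → Y) × RootedForest {v // v ∉ S} {v // v ∈ S} =>
      (⟨glue S p.1 p.2, children_glue S p.1 p.2⟩ :
        {f : RootedForest N Y // f.children = S})) := by
  classical
  have hinj : Function.Injective
      (Sum.elim Subtype.val Subtype.val : {v // v ∉ S} ⊕ {v // v ∈ S} → N) := by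
    rintro (a | a) (b | b) hab
    · exact congrArg _ (Subtype.ext hab)
    · exact (a.2 ((show a.1 = b.1 from hab) ▸ b.2)).elim
    · exact (b.2 ((show a.1 = b.1 from hab) ▸ a.2)).elim
    · exact congrArg _ (Subtype.ext hab)
  constructor
  · rintro ⟨g, f⟩ ⟨g', f'⟩ hgf
    have key : ∀ v, (glue S g f).1 v = (glue S g' f').1 v :=
      fun v => congrFun (congrArg (fun p => p.1.1) hgf) v
    refine Prod.ext ?_ (Subtype.ext ?_)
    · funext v
      have := key v
      rw [glue_of_mem v.2, glue_of_mem v.2] at this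
      exact Sum.inr_injective this
    · funext v
      have := key v
      rw [glue_of_not_mem v.2, glue_of_not_mem v.2] at this
      exact hinj (Sum.inl_injective this)
  · rintro ⟨⟨f, h, hh⟩, hf⟩
    have hf' (v : N) : v ∈ S ↔ ∃ y, f v = .inr y := by rw [← hf, mem_children]
    have h₁ : ∀ v : {v // v ∈ S}, ∃ y, f v = .inr y := fun v => (hf' v).1 v.2
    have h₂ : ∀ v : {v // v ∉ S}, ∃ w : {v // v ∉ S} ⊕ {v // v ∈ S},
        f v = .inl (w.elim Subtype.val Subtype.val) := by
      intro v
      cases hv : f v with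
      | inl w =>
        by_cases hw : w ∈ S
        · exact ⟨.inr ⟨w, hw⟩, rfl⟩
        · exact ⟨.inl ⟨w, hw⟩, rfl⟩
      | inr y => exact (v.2 ((hf' v).2 ⟨y, hv⟩)).elim
    choose g hg using h₁
    choose f' hf'' using h₂
    refine ⟨⟨g, f', fun v => h v, fun v w hvw => hh _ _ ?_⟩, Subtype.ext (Subtype.ext ?_)⟩
    · rw [hf'', hvw]
      rfl
    · funext v
      by_cases hv : v ∈ S
      · exact (glue_of_mem hv).trans (hg ⟨v, hv⟩).symm
      · exact (glue_of_not_mem hv).trans (hf'' ⟨v, hv⟩).symm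

theorem card_eq_sum (N Y : Type) [Fintype N] [Finite Y] :
    Nat.card (RootedForest N Y) = ∑ S : Finset N,
      Nat.card Y ^ S.card * Nat.card (RootedForest {v // v ∉ S} {v // v ∈ S}) := by
  rw [← Nat.card_congr (Equiv.sigmaFiberEquiv (children (N := N) (Y := Y))), Nat.card_sigma]
  refine Finset.sum_congr rfl fun S _ => ?_
  rw [← Nat.card_congr (Equiv.ofBijective _ (bijective_glue S)), Nat.card_prod, Nat.card_fun]
  simp

theorem isEmpty_of_isEmpty (N Y : Type) [Nonempty N] [IsEmpty Y] : IsEmpty (RootedForest N Y) := by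
  refine ⟨fun ⟨f, h, hh⟩ => ?_⟩
  have key : ∀ k v, h v = k → False := by
    intro k
    induction k using Nat.strong_induction_on with
    | _ k ih =>
      intro v hv
      cases hf : f v with
      | inl w => exact ih (h w) (hv ▸ hh v w hf) w rfl
      | inr y => exact isEmptyElim y
  exact key _ (Classical.arbitrary N) rfl

/-- Absorption, s·C(n,s) = n·C(n-1,s-1), followed by the binomial theorem. -/
theorem sum_card_mul_pow_mul_pow (n y : ℕ) (N : Type) [Fintype N] (hn : Fintype.card N = n) :
    ∑ S : Finset N, S.card * (y ^ S.card * n ^ (n - S.card)) = n * (y * (y + n) ^ (n - 1)) := by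
  subst hn
  rw [← Finset.powerset_univ,
    Finset.sum_powerset_apply_card (fun s => s * (y ^ s * Fintype.card N ^ (Fintype.card N - s))),
    Finset.card_univ]
  cases Fintype.card N with
  | zero => simp
  | succ m =>
    rw [Finset.sum_range_succ', Nat.add_sub_cancel, add_pow y (m + 1), Finset.mul_sum,
      Finset.mul_sum, zero_mul, smul_zero, add_zero]
    refine Finset.sum_congr rfl fun k _ => ?_
    have := Nat.add_one_mul_choose_eq m k
    rw [smul_eq_mul, Nat.cast_id, Nat.add_sub_add_right, ← mul_assoc, ← this]
    ring

/-- The number of rooted forests with given roots. -/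
theorem card_mul (N Y : Type) [Finite N] [Finite Y] :
    (Nat.card N + Nat.card Y) * Nat.card (RootedForest N Y) =
      Nat.card Y * (Nat.card N + Nat.card Y) ^ Nat.card N := by
  classical
  induction hn : Nat.card N using Nat.strong_induction_on generalizing N Y with
  | _ n ih =>
    have := Fintype.ofFinite N
    rcases isEmpty_or_nonempty N with hN | hN
    · have hn₀ : n = 0 := by rw [← hn, Nat.card_of_isEmpty]
      have : Unique (RootedForest N Y) :=
        ⟨⟨⟨isEmptyElim, isEmptyElim, fun v => isEmptyElim v⟩⟩,
          fun f => Subtype.ext (funext fun v => isEmptyElim v)⟩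
      simp [hn₀]
    have hn' : Fintype.card N = n := by rw [← hn, Nat.card_eq_fintype_card]
    have hpos : 0 < n := hn ▸ Nat.card_pos
    have step (S : Finset N) : n * Nat.card (RootedForest {v // v ∉ S} {v // v ∈ S}) =
        S.card * n ^ (n - S.card) := by
      -- For S = ∅ the complement is not smaller, so the induction hypothesis is unavailable; but
      -- without roots there is no forest.
      rcases S.eq_empty_or_nonempty with rfl | hS
      · have : Nonempty {v // v ∉ (∅ : Finset N)} := ⟨⟨Classical.arbitrary N, by simp⟩⟩
        have : IsEmpty {v // v ∈ (∅ : Finset N)} := ⟨fun v => Finset.notMem_empty _ v.2⟩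
        have := isEmpty_of_isEmpty {v // v ∉ (∅ : Finset N)} {v // v ∈ (∅ : Finset N)}
        rw [Nat.card_of_isEmpty, Finset.card_empty, mul_zero, zero_mul]
      · have h₁ : Nat.card {v // v ∈ S} = S.card := by simp
        have h₂ : Nat.card {v // v ∉ S} = n - S.card := by
          rw [Nat.card_eq_fintype_card, Fintype.card_subtype_compl, hn']
          simp
        have hle : S.card ≤ n := hn' ▸ S.card_le_univ
        have := ih (n - S.card) (Nat.sub_lt hpos hS.card_pos) {v // v ∉ S} {v // v ∈ S} h₂
        rwa [h₁, Nat.sub_add_cancel hle] at this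
    have hsum : n * Nat.card (RootedForest N Y) =
        n * (Nat.card Y * (Nat.card Y + n) ^ (n - 1)) := by
      rw [← sum_card_mul_pow_mul_pow n (Nat.card Y) N hn', card_eq_sum, Finset.mul_sum]
      refine Finset.sum_congr rfl fun S _ => ?_
      rw [mul_left_comm, step]
      ring
    rw [Nat.eq_of_mul_eq_mul_left hpos hsum, add_comm n, mul_left_comm, ← pow_succ',
      Nat.sub_add_cancel hpos]

end RootedForest

/-! ### Parent functions and Cayley's formula. -/

/-- The functions sending each vertex of a tree with root `r` to its parent, and `r` to itself. -/
def IsParentFun {B : Type} (r : B) (f : B → B) : Prop :=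
  f r = r ∧ ∃ h : B → ℕ, ∀ v, v ≠ r → h (f v) < h v

/-- Parent functions with root `r` as rooted forests with a single root. -/
theorem card_isParentFun_eq_card_rootedForest {B : Type} (r : B) :
    Nat.card {f : B → B // IsParentFun r f} = Nat.card (RootedForest {v : B // v ≠ r} Unit) := by
  classical
  symm
  let F (f : {v : B // v ≠ r} → {v : B // v ≠ r} ⊕ Unit) (v : B) : B :=
    if hv : v = r then r else (f ⟨v, hv⟩).elim Subtype.val fun _ => r
  have hF₁ (f) : F f r = r := by simp [F]
  have hF₂ (f) (v : {v : B // v ≠ r}) : F f v = (f v).elim Subtype.val fun _ => r := by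
    simp [F, v.2]
  have hinj : Function.Injective
      (Sum.elim Subtype.val (fun _ => r) : {v : B // v ≠ r} ⊕ Unit → B) := by
    rintro (a | a) (b | b) hab
    · exact congrArg _ (Subtype.ext hab)
    · exact (a.2 hab).elim
    · exact (b.2 hab.symm).elim
    · rfl
  refine Nat.card_congr (Equiv.ofBijective (fun f => ⟨F f.1, hF₁ f.1, ?_⟩) ⟨?_, ?_⟩)
  · obtain ⟨f, h, hh⟩ := f
    refine ⟨fun v => if hv : v = r then 0 else h ⟨v, hv⟩ + 1, fun v hv => ?_⟩
    have := hF₂ f ⟨v, hv⟩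
    dsimp only at this ⊢
    rw [this]
    cases hf : f ⟨v, hv⟩ with
    | inl w => simpa [hv, w.2] using hh _ _ hf
    | inr w => simp [hv]
  · rintro ⟨f, hf⟩ ⟨g, hg⟩ hfg
    refine Subtype.ext (funext fun v => hinj ?_)
    rw [← hF₂, ← hF₂]
    exact congrFun (congrArg Subtype.val hfg) v
  · rintro ⟨g, hg, h, hh⟩
    have hex (v : {v : B // v ≠ r}) : ∃ w : {v : B // v ≠ r} ⊕ Unit,
        g v = w.elim Subtype.val fun _ => r := by
      by_cases hv : g v = r
      · exact ⟨.inr (), hv⟩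
      · exact ⟨.inl ⟨g v, hv⟩, rfl⟩
    choose f hf using hex
    refine ⟨⟨f, fun v => h v, fun v w hvw => ?_⟩, Subtype.ext (funext fun v => ?_)⟩
    · have := hh v v.2
      rwa [hf, hvw] at this
    · by_cases hv : v = r
      · exact hv ▸ (hF₁ f).trans hg.symm
      · exact (hF₂ f ⟨v, hv⟩).trans (hf ⟨v, hv⟩).symm

/-- The forest count with one root and k - 1 other vertices, divided by k. The integer exponent
covers k = 1, where 1^(-1) = 1. -/
theorem card_isParentFun {B : Type} [Finite B] (r : B) :
    (Nat.card {f : B → B // IsParentFun r f} : ℚ) = (Nat.card B : ℚ) ^ ((Nat.card B : ℤ) - 2) := by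
  have := Fintype.ofFinite B
  have hpos : 0 < Nat.card B := by have : Nonempty B := ⟨r⟩; exact Nat.card_pos
  have hN : Nat.card {v : B // v ≠ r} + 1 = Nat.card B := by
    classical
    rw [Nat.card_eq_fintype_card, Nat.card_eq_fintype_card, Fintype.card_subtype_compl,
      Fintype.card_subtype_eq]
    rw [Nat.card_eq_fintype_card] at hpos
    omega
  have h := RootedForest.card_mul {v : B // v ≠ r} Unit
  rw [← card_isParentFun_eq_card_rootedForest, Nat.card_unique (α := Unit), one_mul] at h
  generalize Nat.card {f : B → B // IsParentFun r f} = c at *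
  generalize Nat.card {v : B // v ≠ r} = m at *
  rw [hN] at h
  have hne : (Nat.card B : ℚ) ≠ 0 := by exact_mod_cast hpos.ne'
  refine mul_left_cancel₀ hne ?_
  rw [← Nat.cast_mul, h, ← zpow_one_add₀ hne, Nat.cast_pow, ← zpow_natCast]
  congr 1
  omega

namespace IsParentFun

variable {B : Type} {r : B} {f : B → B}

theorem ne_self (hf : IsParentFun r f) {v : B} (hv : v ≠ r) : f v ≠ v := by
  obtain ⟨-, h, hh⟩ := hf
  intro hfv
  exact (hh v hv).ne (congrArg h hfv)

theorem exists_iterate (hf : IsParentFun r f) (v : B) : ∃ i, f^[i] v = r := by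
  obtain ⟨hr, h, hh⟩ := hf
  induction hn : h v using Nat.strong_induction_on generalizing v with
  | _ n ih =>
    by_cases hv : v = r
    · exact ⟨0, hv⟩
    · obtain ⟨i, hi⟩ := ih (h (f v)) (hn ▸ hh v hv) (f v) rfl
      exact ⟨i + 1, hi⟩

theorem of_iterate (hr : f r = r) (hf : ∀ v, ∃ i, f^[i] v = r) : IsParentFun r f := by
  classical
  refine ⟨hr, fun v => Nat.find (hf v), fun v hv => ?_⟩
  have h := Nat.find_spec (hf v)
  show Nat.find (hf (f v)) < Nat.find (hf v)
  cases hn : Nat.find (hf v) with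
  | zero => rw [hn] at h; exact (hv h).elim
  | succ k =>
    rw [hn] at h
    exact Nat.lt_succ_of_le (Nat.find_min' (hf (f v)) h)

/-- The tree with a given parent function. -/
def graph (f : B → B) : SimpleGraph B := SimpleGraph.fromRel fun u v => f u = v

theorem reachable_root (hf : IsParentFun r f) (v : B) : (graph f).Reachable v r := by
  obtain ⟨i, hi⟩ := hf.exists_iterate v
  induction i generalizing v with
  | zero => exact hi ▸ SimpleGraph.Reachable.refl _
  | succ i ih =>
    refine SimpleGraph.Reachable.trans ?_ (ih (f v) hi)
    by_cases hv : v = f v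
    · exact hv ▸ SimpleGraph.Reachable.refl _
    · exact SimpleGraph.Adj.reachable ((SimpleGraph.fromRel_adj _ _ _).2 ⟨hv, Or.inl rfl⟩)

theorem connected_graph (hf : IsParentFun r f) : (graph f).Connected := by
  have : Nonempty B := ⟨r⟩
  exact ⟨fun u v => (hf.reachable_root u).trans (hf.reachable_root v).symm⟩

/-- Every edge joins some v ≠ r to its parent, so this connected graph has fewer edges than
vertices. -/
theorem isTree_graph [Finite B] (hf : IsParentFun r f) : (graph f).IsTree := by
  classical
  have := Fintype.ofFinite B
  have hc := hf.connected_graph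
  refine SimpleGraph.isTree_iff_connected_and_card.2 ⟨hc, le_antisymm ?_
    hc.card_vert_le_card_edgeSet_add_one⟩
  have hsub : (graph f).edgeSet ⊆ (fun v => s(v, f v)) '' {v | v ≠ r} := by
    intro e
    induction e with
    | _ u v =>
      rw [SimpleGraph.mem_edgeSet, graph, SimpleGraph.fromRel_adj]
      rintro ⟨huv, h | h⟩
      · exact ⟨u, fun hu => huv (by rw [← h, hu, hf.1]), by simp [h]⟩
      · exact ⟨v, fun hv => huv (by rw [← h, hv, hf.1]), by simp [h]⟩
  have h₁ : Nat.card (graph f).edgeSet ≤ Nat.card {v : B // v ≠ r} :=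
    (Nat.card_mono (Set.toFinite _) hsub).trans (Set.ncard_image_le (Set.toFinite _))
  have h₂ : Nat.card {v : B // v ≠ r} < Nat.card B := Finite.card_subtype_lt (x := r) (not_not.2 rfl)
  omega

/-- A parent function is determined by its tree. -/
theorem eq_of_graph_eq {g : B → B} (hf : IsParentFun r f) (hg : IsParentFun r g)
    (h : graph f = graph g) : f = g := by
  have hf' := hf
  obtain ⟨hr, rk, hrk⟩ := hf'
  funext v
  induction hn : rk v using Nat.strong_induction_on generalizing v with
  | _ n ih =>
    by_cases hv : v = r
    · rw [hv, hr, hg.1]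
    have hw : f (f v) = g (f v) := ih _ (hn ▸ hrk v hv) _ rfl
    have hadj : (graph g).Adj v (f v) := by
      rw [← h, graph, SimpleGraph.fromRel_adj]
      exact ⟨(hf.ne_self hv).symm, Or.inl rfl⟩
    rw [graph, SimpleGraph.fromRel_adj] at hadj
    refine (hadj.2.resolve_right fun h' => ?_).symm
    rw [← hw] at h'
    by_cases hfv : f v = r
    · rw [hfv, hr] at h'
      exact hv h'.symm
    · have h₁ := hrk _ hfv
      rw [h'] at h₁
      exact lt_asymm h₁ (hrk v hv)

end IsParentFun

theorem SimpleGraph.IsTree.exists_parentFun {B : Type} [Finite B] (r : B) {T : SimpleGraph B}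
    (hT : T.IsTree) : ∃ f, IsParentFun r f ∧ IsParentFun.graph f = T := by
  have hex (v : B) : ∃ w, (v = r → w = r) ∧ (v ≠ r → T.Adj v w ∧ T.dist w r < T.dist v r) := by
    by_cases hv : v = r
    · exact ⟨r, fun _ => rfl, fun h => (h hv).elim⟩
    · obtain ⟨p, hp⟩ := (hT.1 v r).exists_walk_length_eq_dist
      cases p with
      | nil => exact (hv rfl).elim
      | cons hvw p =>
        refine ⟨_, fun h => (hv h).elim, fun _ => ⟨hvw, ?_⟩⟩
        rw [← hp, SimpleGraph.Walk.length_cons]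
        exact Nat.lt_succ_of_le (SimpleGraph.dist_le p)
  choose f hf₁ hf₂ using hex
  have hf : IsParentFun r f := ⟨hf₁ r rfl, fun v => T.dist v r, fun v hv => (hf₂ v hv).2⟩
  refine ⟨f, hf, ?_⟩
  have hle : IsParentFun.graph f ≤ T := by
    intro u v
    rw [IsParentFun.graph, SimpleGraph.fromRel_adj]
    have key : ∀ u, u ≠ f u → T.Adj u (f u) := fun u hu =>
      (hf₂ u fun hur => hu (by rw [hur, hf.1])).1
    rintro ⟨huv, rfl | rfl⟩
    · exact key u huv
    · exact (key v huv.symm).symm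
  -- A tree is a minimal connected graph, so its connected subgraph `graph f` is all of it.
  exact le_antisymm hle
    ((SimpleGraph.isTree_iff_minimal_connected.1 hT).2 hf.connected_graph hle)

theorem SimpleGraph.card_isTree {B : Type} [Finite B] [Nonempty B] :
    (Nat.card {T : SimpleGraph B // T.IsTree} : ℚ) =
      (Nat.card B : ℚ) ^ ((Nat.card B : ℤ) - 2) := by
  obtain ⟨r⟩ := ‹Nonempty B›
  rw [← card_isParentFun r]
  refine congrArg _ (Nat.card_congr (Equiv.ofBijective
    (fun f => ⟨IsParentFun.graph f.1, f.2.isTree_graph⟩) ⟨?_, ?_⟩)).symm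
  · rintro ⟨f, hf⟩ ⟨g, hg⟩ hfg
    exact Subtype.ext (hf.eq_of_graph_eq hg (congrArg Subtype.val hfg))
  · rintro ⟨T, hT⟩
    obtain ⟨f, hf, rfl⟩ := hT.exists_parentFun r
    exact ⟨⟨f, hf⟩, rfl⟩

/-! ### Tree orders as ancestor relations. -/

/-- A partial order with least element `o` in which the elements below any element form a chain. -/
structure IsTreeOrder {B : Type} (o : B) (le : B → B → Prop) : Prop
    extends IsTreePreorder o le where
  antisymm : ∀ u v, le u v → le v u → u = v

/-- The ancestor relation of a parent function. -/
def ancestor {B : Type} (f : B → B) (u v : B) : Prop := ∃ i, f^[i] v = u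

namespace IsParentFun

variable {B : Type} {r : B} {f : B → B}

theorem iterate_le (h : B → ℕ) (hr : f r = r) (hh : ∀ v, v ≠ r → h (f v) < h v) (i : ℕ) (v : B) :
    h (f^[i] v) ≤ h v := by
  induction i generalizing v with
  | zero => exact le_rfl
  | succ i ih =>
    refine (ih (f v)).trans ?_
    by_cases hv : v = r
    · rw [hv, hr]
    · exact (hh v hv).le

theorem iterate_root (hf : IsParentFun r f) (i : ℕ) : f^[i] r = r :=
  Function.iterate_fixed hf.1 i

theorem ancestor_of_ancestor_parent {u v : B} (h : ancestor f u (f v)) : ancestor f u v := by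
  obtain ⟨i, hi⟩ := h
  exact ⟨i + 1, hi⟩

theorem eq_or_ancestor_parent {u v : B} (h : ancestor f u v) : u = v ∨ ancestor f u (f v) := by
  obtain ⟨_ | i, hi⟩ := h
  · exact Or.inl hi.symm
  · exact Or.inr ⟨i, hi⟩

theorem isTreeOrder_ancestor (hf : IsParentFun r f) : IsTreeOrder r (ancestor f) where
  refl u := ⟨0, rfl⟩
  trans := by
    rintro u v w ⟨i, hi⟩ ⟨j, hj⟩
    exact ⟨i + j, by rw [Function.iterate_add_apply, hj, hi]⟩
  chain := by
    rintro u v w ⟨i, rfl⟩ ⟨j, rfl⟩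
    rcases le_total i j with hij | hij
    · exact Or.inr ⟨j - i, by rw [← Function.iterate_add_apply, Nat.sub_add_cancel hij]⟩
    · exact Or.inl ⟨i - j, by rw [← Function.iterate_add_apply, Nat.sub_add_cancel hij]⟩
  bot u := hf.exists_iterate u
  antisymm := by
    have hf' := hf
    obtain ⟨hr, h, hh⟩ := hf'
    rintro u v huv ⟨j, hj⟩
    rcases eq_or_ancestor_parent huv with huv | ⟨i, hi⟩
    · exact huv
    by_cases hv : v = r
    · rw [← hi, hv, hr, hf.iterate_root]
    · have h₁ := iterate_le h hr hh i (f v)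
      have h₂ := iterate_le h hr hh j u
      rw [hi] at h₁
      rw [hj] at h₂
      exact absurd (hh v hv) (h₂.trans h₁).not_gt

theorem ancestor_parent_of_eq {g : B → B} (hf : IsParentFun r f) (hg : IsParentFun r g)
    (h : ancestor f = ancestor g) (v : B) : ancestor f (f v) (g v) := by
  by_cases hv : v = r
  · rw [hv, hf.1, hg.1]
    exact ⟨0, rfl⟩
  · have hfv : ancestor g (f v) v := h ▸ ⟨1, rfl⟩
    rw [h]
    exact (eq_or_ancestor_parent hfv).resolve_left (hf.ne_self hv)

theorem ancestor_injective {g : B → B} (hf : IsParentFun r f) (hg : IsParentFun r g)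
    (h : ancestor f = ancestor g) : f = g :=
  funext fun v => hf.isTreeOrder_ancestor.antisymm _ _ (hf.ancestor_parent_of_eq hg h v)
    (h ▸ hg.ancestor_parent_of_eq hf h.symm v)

end IsParentFun

theorem IsTreeOrder.exists_parentFun {B : Type} [Finite B] {r : B} {le : B → B → Prop}
    (h : IsTreeOrder r le) : ∃ f, IsParentFun r f ∧ ancestor f = le := by
  have hwf := h.wellFounded_lt
  have hex (v : B) : ∃ w, (v = r → w = r) ∧
      (v ≠ r → (le w v ∧ ¬ le v w) ∧ ∀ u, le u v → ¬ le v u → le u w) := by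
    by_cases hv : v = r
    · exact ⟨r, fun _ => rfl, fun h => (h hv).elim⟩
    · obtain ⟨w, ⟨hwv, hvw⟩, hmax⟩ := Set.exists_max_image {u | le u v ∧ ¬ le v u}
        (fun u => {x | le x u}.ncard) (Set.toFinite _)
        ⟨r, h.bot v, fun h' => hv (h.antisymm _ _ h' (h.bot v))⟩
      refine ⟨w, fun h => (hv h).elim, fun _ => ⟨⟨hwv, hvw⟩, fun u huv hvu => ?_⟩⟩
      refine (h.chain u w v huv hwv).elim id fun hwu => ?_
      have : {x | le x w} = {x | le x u} :=
        Set.eq_of_subset_of_ncard_le (fun x hx => h.trans _ _ _ hx hwu) (hmax u ⟨huv, hvu⟩)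
          (Set.toFinite _)
      exact (Set.ext_iff.1 this u).2 (h.refl u)
  choose f hf₁ hf₂ using hex
  have hf : IsParentFun r f := by
    refine IsParentFun.of_iterate (hf₁ r rfl) fun v => ?_
    induction v using hwf.induction with
    | _ v ih =>
      by_cases hv : v = r
      · exact ⟨0, hv⟩
      · obtain ⟨i, hi⟩ := ih (f v) (hf₂ v hv).1
        exact ⟨i + 1, hi⟩
  refine ⟨f, hf, ?_⟩
  have hle (v : B) : le (f v) v := by
    by_cases hv : v = r
    · rw [hv, hf.1]
      exact h.refl r
    · exact (hf₂ v hv).1.1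
  funext u v
  rw [eq_iff_iff]
  constructor
  · rintro ⟨i, rfl⟩
    induction i generalizing v with
    | zero => exact h.refl v
    | succ i ih => exact h.trans _ _ _ (ih (f v)) (hle v)
  · intro huv
    induction v using hwf.induction with
    | _ v ih =>
      by_cases hvu : le v u
      · exact ⟨0, h.antisymm _ _ hvu huv⟩
      · have hv : v ≠ r := fun hv => hvu (hv ▸ h.bot u)
        exact IsParentFun.ancestor_of_ancestor_parent
          (ih (f v) (hf₂ v hv).1 ((hf₂ v hv).2 u huv hvu))

theorem card_isTreeOrder {B : Type} [Finite B] (r : B) :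
    (Nat.card {le : B → B → Prop // IsTreeOrder r le} : ℚ) =
      (Nat.card B : ℚ) ^ ((Nat.card B : ℤ) - 2) := by
  rw [← card_isParentFun r]
  refine congrArg _ (Nat.card_congr (Equiv.ofBijective
    (fun f => ⟨ancestor f.1, f.2.isTreeOrder_ancestor⟩) ⟨?_, ?_⟩)).symm
  · rintro ⟨f, hf⟩ ⟨g, hg⟩ hfg
    exact Subtype.ext (hf.ancestor_injective hg (congrArg Subtype.val hfg))
  · rintro ⟨le, h⟩
    obtain ⟨f, hf, rfl⟩ := h.exists_parentFun
    exact ⟨⟨f, hf⟩, rfl⟩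

/-! ### Partitions and Stirling numbers. -/

namespace Finpartition

variable {W : Type} [Fintype W] [DecidableEq W]

/-- The part of a finpartition of a whole type that contains a given element. -/
def toPart (P : Finpartition (Finset.univ : Finset W)) (w : W) : P.parts :=
  ⟨P.part w, P.part_mem.2 (Finset.mem_univ w)⟩

theorem toPart_surjective (P : Finpartition (Finset.univ : Finset W)) :
    Function.Surjective P.toPart := by
  rintro ⟨p, hp⟩
  obtain ⟨w, -, hw⟩ := P.part_surjOn hp
  exact ⟨w, Subtype.ext hw⟩

theorem toPart_eq_iff (P : Finpartition (Finset.univ : Finset W)) {u v : W} :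
    P.toPart u = P.toPart v ↔ u ∈ P.part v := by
  rw [P.mem_part_iff_part_eq_part (Finset.mem_univ _) (Finset.mem_univ _)]
  exact Subtype.ext_iff

theorem ext_toPart {P Q : Finpartition (Finset.univ : Finset W)}
    (h : ∀ u v, P.toPart u = P.toPart v ↔ Q.toPart u = Q.toPart v) : P = Q := by
  have hpart (v : W) : P.part v = Q.part v := by
    ext u
    rw [← toPart_eq_iff, ← toPart_eq_iff, h]
  have hparts (R : Finpartition (Finset.univ : Finset W)) :
      R.parts = Finset.univ.image R.part := by
    ext p
    rw [Finset.mem_image]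
    constructor
    · intro hp
      obtain ⟨w, hw, hwp⟩ := R.part_surjOn hp
      exact ⟨w, hw, hwp⟩
    · rintro ⟨w, hw, rfl⟩
      exact R.part_mem.2 hw
  refine Finpartition.ext ?_
  rw [hparts P, hparts Q, funext hpart]

open Classical in
/-- The finpartition into the classes of a setoid. -/
noncomputable def ofClasses (s : Setoid W) : Finpartition (Finset.univ : Finset W) :=
  ofSetoid s

theorem toPart_ofClasses (s : Setoid W) (u v : W) :
    (ofClasses s).toPart u = (ofClasses s).toPart v ↔ s u v := by
  classical
  rw [toPart_eq_iff, ofClasses]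
  refine Iff.trans ?_ (Setoid.comm' s)
  convert mem_part_ofSetoid_iff_rel (s := s)

theorem ofClasses_eq_iff (s : Setoid W) (P : Finpartition (Finset.univ : Finset W)) :
    ofClasses s = P ↔ ∀ u v, P.toPart u = P.toPart v ↔ s u v := by
  constructor
  · rintro rfl
    exact toPart_ofClasses s
  · intro h
    refine ext_toPart fun u v => ?_
    rw [toPart_ofClasses, h]

/-- Functions to `Fin x` are sorted by their partition into fibres; those with partition P are the
injections from its blocks. Comparison with the Stirling expansion of x^m then identifies the
numbers of partitions. -/
theorem pow_eq_sum_descFactorial (x : ℕ) :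
    x ^ Fintype.card W = ∑ P : Finpartition (Finset.univ : Finset W),
      x.descFactorial P.parts.card := by
  have h : Nat.card (W → Fin x) = x ^ Fintype.card W := by simp
  rw [← h, ← Nat.card_congr (Equiv.sigmaFiberEquiv
    fun f : W → Fin x => ofClasses (Setoid.ker f)), Nat.card_sigma]
  refine Finset.sum_congr rfl fun P _ => ?_
  have hemb : Nat.card (P.parts ↪ Fin x) = x.descFactorial P.parts.card := by
    rw [Nat.card_eq_fintype_card, Fintype.card_embedding_eq]
    simp
  rw [← hemb]
  have hmem (e : P.parts ↪ Fin x) : ofClasses (Setoid.ker (e ∘ P.toPart)) = P :=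
    (ofClasses_eq_iff _ _).2 fun _ _ => e.injective.eq_iff.symm
  refine (Nat.card_congr (Equiv.ofBijective
    (fun e : P.parts ↪ Fin x => ⟨e ∘ P.toPart, hmem e⟩) ⟨?_, ?_⟩)).symm
  · intro e e' h
    refine DFunLike.coe_injective (P.toPart_surjective.injective_comp_right ?_)
    exact congrArg Subtype.val h
  · rintro ⟨f, hf⟩
    rw [ofClasses_eq_iff] at hf
    have hs := Function.rightInverse_surjInv P.toPart_surjective
    refine ⟨⟨fun p => f (Function.surjInv P.toPart_surjective p), fun p q hpq => ?_⟩,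
      Subtype.ext (funext fun w => ?_)⟩
    · rw [← hs p, ← hs q]
      exact (hf _ _).2 hpq
    · exact (hf _ _).1 (hs (P.toPart w))

end Finpartition

theorem Nat.pow_eq_sum_stirlingSecond_mul_descFactorial (m x : ℕ) :
    x ^ m = ∑ k ∈ Finset.range (m + 1), Nat.stirlingSecond m k * x.descFactorial k := by
  induction m with
  | zero => simp
  | succ m ih =>
    have hx (k : ℕ) : x * x.descFactorial k = x.descFactorial (k + 1) + k * x.descFactorial k := by
      rw [Nat.descFactorial_succ]
      rcases le_or_gt k x with h | h
      · rw [← add_mul, Nat.sub_add_cancel h]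
      · simp [Nat.descFactorial_of_lt h]
    rw [pow_succ', ih, Finset.mul_sum, Finset.sum_range_succ' _ (m + 1)]
    simp only [Nat.stirlingSecond_succ_zero, zero_mul, add_zero, Nat.stirlingSecond_succ_succ,
      add_mul _ (Nat.stirlingSecond _ _) (x.descFactorial _), Finset.sum_add_distrib]
    have h₁ : ∑ k ∈ Finset.range (m + 1),
        (k + 1) * Nat.stirlingSecond m (k + 1) * x.descFactorial (k + 1) =
        ∑ k ∈ Finset.range (m + 1), k * Nat.stirlingSecond m k * x.descFactorial k := by
      have := Finset.sum_range_succ'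
        (fun k => k * Nat.stirlingSecond m k * x.descFactorial k) (m + 1)
      rw [Finset.sum_range_succ, Nat.stirlingSecond_eq_zero_of_lt (Nat.lt_succ_self m)] at this
      simpa using this.symm
    rw [h₁, ← Finset.sum_add_distrib]
    refine Finset.sum_congr rfl fun k _ => ?_
    rw [mul_left_comm, hx]
    ring

/-- The coefficients of a combination of falling factorials are determined by its values. -/
theorem Nat.eq_of_sum_mul_descFactorial_eq {m : ℕ} {a b : ℕ → ℕ}
    (h : ∀ x : ℕ, ∑ k ∈ Finset.range m, a k * x.descFactorial k =
      ∑ k ∈ Finset.range m, b k * x.descFactorial k) {k : ℕ} (hk : k < m) : a k = b k := by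
  induction k using Nat.strong_induction_on with
  | _ k ih =>
    -- At x = k the terms beyond k vanish and the earlier ones agree by induction, leaving the
    -- coefficient of k! on each side.
    have hx := h k
    rw [← Finset.add_sum_erase _ _ (Finset.mem_range.2 hk),
      ← Finset.add_sum_erase _ (fun k' => b k' * _) (Finset.mem_range.2 hk)] at hx
    have hrest : ∑ j ∈ (Finset.range m).erase k, a j * k.descFactorial j =
        ∑ j ∈ (Finset.range m).erase k, b j * k.descFactorial j := by
      refine Finset.sum_congr rfl fun j hj => ?_
      rw [Finset.mem_erase, Finset.mem_range] at hj
      rcases lt_or_gt_of_ne hj.1 with hjk | hjk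
      · rw [ih j hjk hj.2]
      · simp [Nat.descFactorial_of_lt hjk]
    rw [hrest] at hx
    refine Nat.eq_of_mul_eq_mul_right (Nat.descFactorial_pos.2 le_rfl) (Nat.add_right_cancel hx)

namespace Finpartition

variable {W : Type} [Fintype W] [DecidableEq W]

theorem sum_comp_card_parts {M : Type} [CommSemiring M] (g : ℕ → M) :
    ∑ P : Finpartition (Finset.univ : Finset W), g P.parts.card =
      ∑ k ∈ Finset.range (Fintype.card W + 1),
        ((Finset.univ.filter fun P : Finpartition (Finset.univ : Finset W) =>
          P.parts.card = k).card : M) * g k := by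
  rw [← Finset.sum_fiberwise_of_maps_to
    (t := Finset.range (Fintype.card W + 1)) (g := fun P => P.parts.card)
    fun P _ => Finset.mem_range.2 (Nat.lt_succ_of_le P.card_parts_le_card)]
  refine Finset.sum_congr rfl fun k _ => ?_
  rw [← nsmul_eq_mul]
  refine Finset.sum_eq_card_nsmul fun P hP => ?_
  rw [(Finset.mem_filter.1 hP).2]

/-- The Stirling numbers of the second kind count finpartitions. -/
theorem card_filter_card_parts_eq {k : ℕ} (hk : k ≤ Fintype.card W) :
    (Finset.univ.filter fun P : Finpartition (Finset.univ : Finset W) =>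
      P.parts.card = k).card = Nat.stirlingSecond (Fintype.card W) k := by
  refine Nat.eq_of_sum_mul_descFactorial_eq (m := Fintype.card W + 1)
    (a := fun k => (Finset.univ.filter fun P : Finpartition (Finset.univ : Finset W) =>
      P.parts.card = k).card) (fun x => ?_) (Nat.lt_succ_of_le hk)
  rw [← Nat.pow_eq_sum_stirlingSecond_mul_descFactorial, pow_eq_sum_descFactorial,
    sum_comp_card_parts]
  rfl

theorem sum_comp_card_parts_eq_sum_stirlingSecond [Nonempty W] (g : ℕ → ℚ) :
    ∑ P : Finpartition (Finset.univ : Finset W), g P.parts.card =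
      ∑ k ∈ Finset.Icc 1 (Fintype.card W), (Nat.stirlingSecond (Fintype.card W) k : ℚ) * g k := by
  rw [sum_comp_card_parts, Finset.range_eq_Ico, Finset.sum_eq_sum_Ico_succ_bot (Nat.succ_pos _)]
  obtain ⟨m, hm⟩ : ∃ m, Fintype.card W = m + 1 :=
    Nat.exists_eq_succ_of_ne_zero Fintype.card_ne_zero
  rw [card_filter_card_parts_eq (Nat.zero_le _)]
  nth_rw 1 [hm]
  rw [Nat.stirlingSecond_succ_zero, Nat.cast_zero, zero_mul, zero_add]
  refine Finset.sum_congr rfl fun k hk => ?_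
  rw [card_filter_card_parts_eq (Nat.lt_succ_iff.1 (Finset.mem_Ico.1 hk).2)]

end Finpartition

/-! ### Counting tree preorders and partition trees. -/

namespace IsTreePreorder

variable {W : Type} {o : W}

/-- The equivalence relation of a tree preorder. -/
def setoid (le : {le : W → W → Prop // IsTreePreorder o le}) : Setoid W where
  r u v := le.1 u v ∧ le.1 v u
  iseqv := ⟨fun u => ⟨le.2.refl u, le.2.refl u⟩, And.symm, fun huv hvw =>
    ⟨le.2.trans _ _ _ huv.1 hvw.1, le.2.trans _ _ _ hvw.2 huv.2⟩⟩

variable [Fintype W] [DecidableEq W]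

/-- Tree preorders with given classes correspond to tree orders on these classes. -/
theorem card_setoid_classes (o : W) (P : Finpartition (Finset.univ : Finset W)) :
    Nat.card {le : {le : W → W → Prop // IsTreePreorder o le} //
        Finpartition.ofClasses (setoid le) = P} =
      Nat.card {le : P.parts → P.parts → Prop // IsTreeOrder (P.toPart o) le} := by
  have hsurj := P.toPart_surjective
  have hpre (le : {le : P.parts → P.parts → Prop // IsTreeOrder (P.toPart o) le}) :
      IsTreePreorder o fun u v => le.1 (P.toPart u) (P.toPart v) :=
    ⟨fun u => le.2.refl _, fun u v w => le.2.trans _ _ _, fun u v w => le.2.chain _ _ _,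
      fun u => le.2.bot _⟩
  have hmem (le : {le : P.parts → P.parts → Prop // IsTreeOrder (P.toPart o) le}) :
      Finpartition.ofClasses (setoid ⟨_, hpre le⟩) = P :=
    (Finpartition.ofClasses_eq_iff _ _).2 fun u v =>
      ⟨fun h => ⟨show le.1 (P.toPart u) (P.toPart v) from h ▸ le.2.refl _,
        show le.1 (P.toPart v) (P.toPart u) from h ▸ le.2.refl _⟩, fun h => le.2.antisymm _ _ h.1 h.2⟩
  refine (Nat.card_congr (Equiv.ofBijective
    (fun le => ⟨⟨_, hpre le⟩, hmem le⟩) ⟨?_, ?_⟩)).symm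
  · rintro ⟨le, hle⟩ ⟨le', hle'⟩ h
    refine Subtype.ext (funext fun p => funext fun q => ?_)
    obtain ⟨u, rfl⟩ := hsurj p
    obtain ⟨v, rfl⟩ := hsurj q
    exact congrFun (congrFun (congrArg (fun r => r.1.1) h) u) v
  · rintro ⟨⟨le, hle⟩, hP⟩
    have hP' : ∀ u v, P.toPart u = P.toPart v ↔ le u v ∧ le v u :=
      (Finpartition.ofClasses_eq_iff _ _).1 hP
    let s := Function.surjInv hsurj
    have hs : ∀ p, P.toPart (s p) = p := Function.rightInverse_surjInv hsurj
    have hs' (u : W) : le (s (P.toPart u)) u ∧ le u (s (P.toPart u)) := (hP' _ _).1 (hs _)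
    refine ⟨⟨fun p q => le (s p) (s q), ?_⟩, Subtype.ext (Subtype.ext ?_)⟩
    · refine ⟨⟨fun p => hle.refl _, fun p q r => hle.trans _ _ _, fun p q r => hle.chain _ _ _,
        fun p => hle.trans _ _ _ (hs' o).1 (hle.bot _)⟩, fun p q hpq hqp => ?_⟩
      rw [← hs p, ← hs q]
      exact (hP' _ _).2 ⟨hpq, hqp⟩
    · funext u v
      exact propext ⟨fun h => hle.trans _ _ _ (hs' u).2 (hle.trans _ _ _ h (hs' v).1),
        fun h => hle.trans _ _ _ (hs' u).1 (hle.trans _ _ _ h (hs' v).2)⟩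

/-- The root of the quotient tree must be the block of o, so each partition into k blocks
contributes k^(k-2). -/
theorem card_eq_sum_stirlingSecond (o : W) :
    (Nat.card {le : W → W → Prop // IsTreePreorder o le} : ℚ) =
      ∑ k ∈ Finset.Icc 1 (Fintype.card W),
        (Nat.stirlingSecond (Fintype.card W) k : ℚ) * (k : ℚ) ^ ((k : ℤ) - 2) := by
  have : Nonempty W := ⟨o⟩
  rw [← Finpartition.sum_comp_card_parts_eq_sum_stirlingSecond fun k => (k : ℚ) ^ ((k : ℤ) - 2),
    ← Nat.card_congr (Equiv.sigmaFiberEquiv fun le => Finpartition.ofClasses (setoid le)),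
    Nat.card_sigma, Nat.cast_sum]
  refine Finset.sum_congr rfl fun P _ => ?_
  rw [card_setoid_classes, card_isTreeOrder, Nat.card_eq_fintype_card, Fintype.card_coe]

end IsTreePreorder

theorem card_partitionTree {m : ℕ} (hm : 1 ≤ m) :
    (Nat.card (PartitionTree m) : ℚ) = ∑ k ∈ Finset.Icc 1 m,
      (Nat.stirlingSecond m k : ℚ) * (k : ℚ) ^ ((k : ℤ) - 2) := by
  have : Nonempty (Fin m) := ⟨⟨0, hm⟩⟩
  have h := Finpartition.sum_comp_card_parts_eq_sum_stirlingSecond (W := Fin m)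
    fun k => (k : ℚ) ^ ((k : ℤ) - 2)
  rw [Fintype.card_fin] at h
  rw [← h, Nat.card_sigma, Nat.cast_sum]
  refine Finset.sum_congr rfl fun P _ => ?_
  have : Nonempty P.parts := ⟨P.toPart ⟨0, hm⟩⟩
  rw [SimpleGraph.card_isTree, Nat.card_eq_fintype_card, Fintype.card_coe]

theorem mainTheorem4 (n : ℕ) (hn : 1 ≤ n) :
    ((qlt n : ℚ) = ∑ k ∈ Finset.Icc 1 (n + 1),
      (Nat.stirlingSecond (n + 1) k : ℚ) * (k : ℚ) ^ ((k : ℤ) - 2)) ∧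
    Nonempty (QLTGraph n ≃ PartitionTree (n + 1)) := by
  have hq : (qlt n : ℚ) = ∑ k ∈ Finset.Icc 1 (n + 1),
      (Nat.stirlingSecond (n + 1) k : ℚ) * (k : ℚ) ^ ((k : ℤ) - 2) := by
    rw [qlt_eq_card_isTreePreorder hn, IsTreePreorder.card_eq_sum_stirlingSecond]
    simp only [Fintype.card_option, Fintype.card_fin]
  -- The bijection comes from equality of the two finite cardinalities.
  refine ⟨hq, Finite.card_eq.1 ?_⟩
  exact_mod_cast hq.trans (card_partitionTree (Nat.le_add_left 1 n)).symm
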